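/- There is a universal constant $c>0$ such that the following holds for every $G>0$ and every $n\ge 256$ that is a multiple of $4$. Put $L=2^{17}$ and, for $\lambda>0$, $1\le i\le n$ and $t\in\mathbb R$, $$g_{\lambda,i}(t)=\tfrac12 t^2+s_i\tfrac{G}{2}t\ \text{ if }t\ge 0,\qquad g_{\lambda,i}(t)=\tfrac{\lambda}{2}t^2+s_i\tfrac{G}{2}t\ \text{ if }t<0,$$ where $s_i=+1$ for $i\le n/2$ and $s_i=-1$ for $i>n/2$. Let $f_i:\mathbb R^2\to\mathbb R$ be $f_i(x)=g_{L,i}(x^{(1)})+g_{1,i}(x^{(2)})$, and let $F=\frac1n\sum_{i=1}^n f_i$. Then each $f_i$ is convex and differentiable with $L$-Lipschitz gradient, $F$ is $1$-strongly convex with a global minimizer $x^*$, and there are an initial point $x_0\in\mathbb R^2$ and a convex set $W\subset\mathbb R^2$ (not depending on the step size or on the number of epochs) such that: (a) $x_0,x^*\in W$; for all $x\in W$ and all $i$ we have $\|x-x^*\|\le\sqrt2\,\frac G2$ and $\|\nabla f_i(x)\|\le\sqrt2\,G$; and $x-\alpha\nabla f_i(x)\in W$ for all $x\in W$, all $i$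 and all $0<\alpha\le 1/L$; (b) for every number of epochs $K\ge1$ and every constant step size $\alpha>0$, SGD without replacement started at $x_0$ (in each epoch an independent, uniformly random permutation $\sigma$ of $\{1,\dots,n\}$ is drawn and the steps $x\leftarrow x-\alpha\nabla f_{\sigma(1)}(x),\dots,x\leftarrow x-\alpha\nabla f_{\sigma(n)}(x)$ are made in this order) satisfies after $T=nK$ steps $$\mathbb E\,\|x_T-x^*\|^2\ \ge\ c\,\frac{G^2n}{T^2}.$$ -/

import Mathlib

open scoped BigOperators

noncomputable section

/-- The average `F = (1/n) ∑ fᵢ` of `n` component functions. -/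
def averageFn {E : Type*} {n : ℕ} (f : Fin n → E → ℝ) (x : E) : ℝ :=
  (1 / (n : ℝ)) * ∑ i, f i x

/-- One epoch of SGD without replacement with step size `α`, started at `x`: the components are
visited in the order `σ 0, σ 1, …, σ (n - 1)`, each with one gradient step. -/
def sgdEpoch {E : Type*} [NormedAddCommGroup E] [InnerProductSpace ℝ E] [CompleteSpace E] {n : ℕ}
    (f : Fin n → E → ℝ) (α : ℝ) (σ : Equiv.Perm (Fin n)) (x : E) : E :=
  Fin.foldl n (fun y i => y - α • gradient (f (σ i)) y) x

/-- The last iterate after `K` epochs (that is, `T = n * K` steps) of SGD without replacement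
with constant step size `α`, started at `x₀`, when the `j`-th epoch uses the permutation `σ j`. -/
def sgdLast {E : Type*} [NormedAddCommGroup E] [InnerProductSpace ℝ E] [CompleteSpace E] {n : ℕ}
    (f : Fin n → E → ℝ) (α : ℝ) (x₀ : E) {K : ℕ} (σ : Fin K → Equiv.Perm (Fin n)) : E :=
  Fin.foldl K (fun x j => sgdEpoch f α (σ j) x) x₀

/-- `𝔼 ‖x_T - x⋆‖²` for `T = n * K`, when the permutations of the `K` epochs are independent and
uniformly distributed: the average over all `K`-tuples of permutations. -/
def sgdExpectedSqError {E : Type*} [NormedAddCommGroup E] [InnerProductSpace ℝ E]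
    [CompleteSpace E] {n : ℕ} (f : Fin n → E → ℝ) (α : ℝ) (x₀ xstar : E) (K : ℕ) : ℝ :=
  𝔼 σ : Fin K → Equiv.Perm (Fin n), ‖sgdLast f α x₀ σ - xstar‖ ^ 2

/-- The one-dimensional components: `x²/2 ± Gx/2` for `x ≥ 0` and `Lx²/2 ± Gx/2` for `x < 0`, with
sign `+` for the first half of the indices and sign `-` for the second half. -/
def pieceComponent (L G : ℝ) {n : ℕ} (i : Fin n) (x : ℝ) : ℝ :=
  (if 0 ≤ x then x ^ 2 / 2 else L * x ^ 2 / 2) +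
    (if 2 * (i : ℕ) < n then G * x / 2 else -(G * x / 2))

end

/-! A gradient step acts on each coordinate separately, with noise `R * s`, where `R = α * G / 2`
and the signs `s` sum to zero over an epoch. The minimizer is `0`, so the error is the sum of the
second moments of two scalar iterations, and it is enough that one of them is large. With `T = n *
K`, three regimes of `α` cover all step sizes.

Large steps, `α ≥ 2⁻²⁸ / n`: in the quadratic coordinate the last epoch alone creates variance of
order `G² / n`. Its noise is a signed sum with geometric weights; sampling without replacement
cancels only their common mean, and the weights are far from constant
(`le_expect_scalarIter_one_sq`).

Small steps, `α ≤ 1 / (2T)`: the mean of the quadratic coordinate is `(1 - α) ^ T * G / 2`, which is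
still at least `G / 4`.

Intermediate steps: the kinked coordinate is biased. In mid-epoch the partial sums of the signs have
size about `√n`, so near `0` the iterate goes negative by about `R * √n`, where the steep slope `L`
pushes it back harder than slope `1` pulls it down on the other side. Hence `θ = R * √n / 1024`
satisfies `θ ≤ M θ` for the one-epoch mean map `M` (`le_epochMean`). As `M` is monotone and convex,
Jensen's inequality keeps the mean above `θ` for all epochs (`le_expect_scalarLast`), and `θ²` is of
order `α² G² n`, hence at least of order `G² n / T²`. -/

open scoped BigOperators

noncomputable section

/-! ### Moments of partial sums of random signs drawn without replacement -/

section Signs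

variable {n : ℕ}

/-- The sign attached to the `i`-th visited component under the permutation `σ`. -/
def permSign (σ : Equiv.Perm (Fin n)) (i : ℕ) : ℝ :=
  if h : i < n then (if 2 * (σ ⟨i, h⟩ : ℕ) < n then 1 else -1) else 0

/-- Partial sums of the signs. -/
def permSum (σ : Equiv.Perm (Fin n)) (i : ℕ) : ℝ := ∑ j ∈ Finset.range i, permSign σ j

lemma permSum_zero (σ : Equiv.Perm (Fin n)) : permSum σ 0 = 0 := by simp [permSum]

lemma permSum_succ (σ : Equiv.Perm (Fin n)) (i : ℕ) :
    permSum σ (i + 1) = permSum σ i + permSign σ i := by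
  simp [permSum, Finset.sum_range_succ]

lemma permSign_sq (σ : Equiv.Perm (Fin n)) {i : ℕ} (h : i < n) : permSign σ i ^ 2 = 1 := by
  unfold permSign
  rw [dif_pos h]
  split_ifs <;> norm_num

lemma permSum_self (hn : 2 ∣ n) (σ : Equiv.Perm (Fin n)) : permSum σ n = 0 := by
  obtain ⟨m, rfl⟩ := hn
  have h1 : permSum σ (2 * m) = ∑ i : Fin (2 * m), (if (σ i : ℕ) < m then (1 : ℝ) else -1) := by
    unfold permSum
    rw [Finset.sum_range]
    refine Finset.sum_congr rfl fun i _ => ?_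
    simp [permSign]
  rw [h1, Equiv.sum_comp σ (fun i : Fin (2 * m) => if (i : ℕ) < m then (1 : ℝ) else -1),
    ← Finset.sum_range (fun i => if i < m then (1 : ℝ) else -1), two_mul,
    Finset.sum_range_add]
  have h2 : ∀ x ∈ Finset.range m, (if x < m then (1 : ℝ) else -1) = 1 := fun x hx =>
    if_pos (Finset.mem_range.1 hx)
  have h3 : ∀ x ∈ Finset.range m, (if m + x < m then (1 : ℝ) else -1) = -1 := fun x _ =>
    if_neg (by omega)
  rw [Finset.sum_congr rfl h2, Finset.sum_congr rfl h3]
  simp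

lemma permSign_mul_swap_of_ne (σ : Equiv.Perm (Fin n)) {i j k : ℕ} (hi : i < n) (hj : j < n)
    (hki : k ≠ i) (hkj : k ≠ j) :
    permSign (σ * Equiv.swap ⟨i, hi⟩ ⟨j, hj⟩) k = permSign σ k := by
  unfold permSign
  split_ifs with h <;> try rfl
  all_goals
    rename_i h1 h2
    rw [Equiv.Perm.mul_apply, Equiv.swap_apply_of_ne_of_ne (by simpa using hki)
      (by simpa using hkj)] at h1
    omega

lemma permSign_mul_swap_left (σ : Equiv.Perm (Fin n)) {i j : ℕ} (hi : i < n) (hj : j < n) :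
    permSign (σ * Equiv.swap ⟨i, hi⟩ ⟨j, hj⟩) i = permSign σ j := by
  simp [permSign, hi, hj]

lemma permSum_mul_swap (σ : Equiv.Perm (Fin n)) {i j k : ℕ} (hi : i < n) (hj : j < n)
    (hki : k ≤ i) (hkj : k ≤ j) :
    permSum (σ * Equiv.swap ⟨i, hi⟩ ⟨j, hj⟩) k = permSum σ k := by
  refine Finset.sum_congr rfl fun l hl => ?_
  have := Finset.mem_range.1 hl
  exact permSign_mul_swap_of_ne σ hi hj (by omega) (by omega)

/-- Exchangeability of the signs. -/
lemma expect_mul_permSign_swap (φ : Equiv.Perm (Fin n) → ℝ) {i j : ℕ} (hi : i < n) (hj : j < n)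
    (hφ : ∀ σ, φ (σ * Equiv.swap ⟨i, hi⟩ ⟨j, hj⟩) = φ σ) :
    𝔼 σ, φ σ * permSign σ j = 𝔼 σ, φ σ * permSign σ i := by
  refine Fintype.expect_equiv (Equiv.mulRight (Equiv.swap ⟨i, hi⟩ ⟨j, hj⟩)) _ _ fun σ => ?_
  rw [Equiv.coe_mulRight, hφ, permSign_mul_swap_left]

/-- The `n - i` signs not yet drawn add up to `-permSum σ i`, and by exchangeability each has the
same correlation with a function of that partial sum. -/
lemma expect_permSum_pow_mul_permSign (hn : 2 ∣ n) {i : ℕ} (hi : i < n) (p : ℕ) :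
    ((n : ℝ) - i) * 𝔼 σ : Equiv.Perm (Fin n), permSum σ i ^ p * permSign σ i
      = -𝔼 σ : Equiv.Perm (Fin n), permSum σ i ^ (p + 1) := by
  have h1 : ∀ σ : Equiv.Perm (Fin n),
      ∑ j ∈ Finset.Ico i n, permSum σ i ^ p * permSign σ j = -permSum σ i ^ (p + 1) := by
    intro σ
    rw [← Finset.mul_sum]
    have := Finset.sum_range_add_sum_Ico (permSign σ) hi.le
    have h0 : ∑ j ∈ Finset.range n, permSign σ j = 0 := permSum_self hn σ
    have h2 : ∑ j ∈ Finset.Ico i n, permSign σ j = -permSum σ i := by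
      rw [permSum]; linarith
    rw [h2]; ring
  rw [← Finset.expect_neg_distrib, ← Finset.expect_congr rfl (fun σ _ => h1 σ),
    Finset.expect_sum_comm]
  rw [Finset.sum_congr rfl (g := fun _ =>
    𝔼 σ : Equiv.Perm (Fin n), permSum σ i ^ p * permSign σ i)]
  · rw [Finset.sum_const, Nat.card_Ico, nsmul_eq_mul, Nat.cast_sub hi.le]
  · intro j hj
    rw [Finset.mem_Ico] at hj
    exact expect_mul_permSign_swap _ hi hj.2 fun σ => by
      rw [permSum_mul_swap σ hi hj.2 le_rfl hj.1]

lemma expect_permSum (hn : 2 ∣ n) {i : ℕ} (hi : i ≤ n) :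
    𝔼 σ : Equiv.Perm (Fin n), permSum σ i = 0 := by
  induction i with
  | zero => simp [permSum_zero]
  | succ i ih =>
    have h := expect_permSum_pow_mul_permSign hn (show i < n by omega) 0
    have h0 := ih (by omega)
    simp only [pow_zero, one_mul, zero_add, pow_one, h0, neg_zero] at h
    have hne : (n : ℝ) - i ≠ 0 := by
      have : (i : ℝ) < n := by exact_mod_cast (show i < n by omega)
      linarith
    simp only [permSum_succ, Finset.expect_add_distrib, h0, zero_add]
    exact (mul_eq_zero.1 h).resolve_left hne

lemma expect_permSign (hn : 2 ∣ n) {i : ℕ} (hi : i < n) :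
    𝔼 σ : Equiv.Perm (Fin n), permSign σ i = 0 := by
  have h := expect_permSum hn (show i + 1 ≤ n from hi)
  simpa only [permSum_succ, Finset.expect_add_distrib, expect_permSum hn hi.le, zero_add] using h

lemma expect_permSum_sq (hn : 2 ∣ n) {i : ℕ} (hi : i ≤ n) :
    ((n : ℝ) - 1) * 𝔼 σ : Equiv.Perm (Fin n), permSum σ i ^ 2 = i * (n - i) := by
  induction i with
  | zero => simp [permSum_zero]
  | succ i ih =>
    have hlt : i < n := by omega
    have h := expect_permSum_pow_mul_permSign hn hlt 1
    have h0 := ih (by omega)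
    have hne : (0 : ℝ) < (n : ℝ) - i := by
      have : (i : ℝ) < n := by exact_mod_cast hlt
      linarith
    have h2 : 𝔼 σ : Equiv.Perm (Fin n), permSum σ (i + 1) ^ 2
        = 𝔼 σ : Equiv.Perm (Fin n), permSum σ i ^ 2
          + 2 * 𝔼 σ : Equiv.Perm (Fin n), permSum σ i ^ 1 * permSign σ i + 1 := by
      rw [Finset.mul_expect, ← Finset.expect_add_distrib,
        ← Fintype.expect_const (ι := Equiv.Perm (Fin n)) (1 : ℝ), ← Finset.expect_add_distrib]
      refine Finset.expect_congr rfl fun σ _ => ?_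
      rw [permSum_succ]
      linear_combination permSign_sq σ hlt
    rw [h2]
    norm_num at h
    push_cast
    simp only [pow_one]
    set A := 𝔼 σ : Equiv.Perm (Fin n), permSum σ i ^ 2
    set B := 𝔼 σ : Equiv.Perm (Fin n), permSum σ i * permSign σ i
    have h3 : ((n : ℝ) - 1) * B = -i := by
      apply mul_left_cancel₀ hne.ne'
      linear_combination ((n : ℝ) - 1) * h - h0
    linear_combination h0 + 2 * h3

lemma expect_permSum_sq_le (hn : 2 ∣ n) {i : ℕ} (hi : i ≤ n) :
    𝔼 σ : Equiv.Perm (Fin n), permSum σ i ^ 2 ≤ i := by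
  rcases Nat.eq_zero_or_pos i with rfl | hpos
  · simp [permSum_zero]
  have h := expect_permSum_sq hn hi
  have h1 : (1 : ℝ) < n := by exact_mod_cast (show 1 < n by omega)
  have h2 : (1 : ℝ) ≤ i := by exact_mod_cast hpos
  refine le_of_mul_le_mul_left ?_ (show (0 : ℝ) < n - 1 by linarith)
  rw [h]
  nlinarith

/-- The next sign is negatively correlated with odd powers of the partial sum, so the cross terms in
the expansion can be dropped and the bound for independent signs survives. -/
lemma expect_permSum_pow_four_le (hn : 2 ∣ n) {i : ℕ} (hi : i ≤ n) :
    𝔼 σ : Equiv.Perm (Fin n), permSum σ i ^ 4 ≤ 3 * (i : ℝ) ^ 2 := by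
  induction i with
  | zero => simp [permSum_zero]
  | succ i ih =>
    have hlt : i < n := by omega
    have hne : (0 : ℝ) < (n : ℝ) - i := by
      have : (i : ℝ) < n := by exact_mod_cast hlt
      linarith
    have h0 := ih (by omega)
    have hs := expect_permSum_sq_le hn hlt.le
    have hodd : ∀ p : ℕ, Even (p + 1) →
        𝔼 σ : Equiv.Perm (Fin n), permSum σ i ^ p * permSign σ i ≤ 0 := by
      intro p hp
      have h := expect_permSum_pow_mul_permSign hn hlt p
      have hnn : 0 ≤ 𝔼 σ : Equiv.Perm (Fin n), permSum σ i ^ (p + 1) :=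
        Finset.expect_nonneg fun σ _ => hp.pow_nonneg _
      by_contra hc
      have := mul_pos hne (not_le.1 hc)
      linarith
    have h1 := hodd 1 (by decide)
    have h3 := hodd 3 (by decide)
    have h2 : 𝔼 σ : Equiv.Perm (Fin n), permSum σ (i + 1) ^ 4
        = 𝔼 σ : Equiv.Perm (Fin n), permSum σ i ^ 4
          + 4 * 𝔼 σ : Equiv.Perm (Fin n), permSum σ i ^ 3 * permSign σ i
          + 6 * 𝔼 σ : Equiv.Perm (Fin n), permSum σ i ^ 2
          + 4 * 𝔼 σ : Equiv.Perm (Fin n), permSum σ i ^ 1 * permSign σ i + 1 := by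
      simp only [Finset.mul_expect]
      rw [← Fintype.expect_const (ι := Equiv.Perm (Fin n)) (1 : ℝ)]
      simp only [← Finset.expect_add_distrib]
      refine Finset.expect_congr rfl fun σ _ => ?_
      rw [permSum_succ]
      have := permSign_sq σ hlt
      linear_combination (permSign σ i ^ 2 + 4 * permSum σ i * permSign σ i
        + 6 * permSum σ i ^ 2 + 1) * this
    rw [h2]
    push_cast
    linarith

lemma expect_abs_permSum_le (hn : 2 ∣ n) (hpos : 0 < n) {i : ℕ} (hi : i ≤ n) :
    𝔼 σ : Equiv.Perm (Fin n), |permSum σ i| ≤ √n := by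
  have hs : 0 < √(n : ℝ) := Real.sqrt_pos.2 (by exact_mod_cast hpos)
  have hsq : √(n : ℝ) ^ 2 = n := Real.sq_sqrt (by positivity)
  have h2 := expect_permSum_sq_le hn hi
  have hin : (i : ℝ) ≤ n := by exact_mod_cast hi
  have h1 : 2 * √n * 𝔼 σ : Equiv.Perm (Fin n), |permSum σ i|
      ≤ 𝔼 σ : Equiv.Perm (Fin n), permSum σ i ^ 2 + n := by
    have hc : 𝔼 σ : Equiv.Perm (Fin n), permSum σ i ^ 2 + n
        = 𝔼 σ : Equiv.Perm (Fin n), (permSum σ i ^ 2 + n) := by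
      rw [Finset.expect_add_distrib, Fintype.expect_const]
    rw [Finset.mul_expect, hc]
    refine Finset.expect_le_expect fun σ _ => ?_
    nlinarith [sq_nonneg (√n - |permSum σ i|), sq_abs (permSum σ i)]
  nlinarith

/-- Fourth-moment method: a second moment of order `n` together with a fourth moment of order `n²`
forces a first absolute moment of order `√n`. -/
lemma le_expect_abs_permSum (hn : 2 ∣ n) (hn2 : 2 ≤ n) {i : ℕ} (hi : n ≤ 4 * i)
    (hi' : 2 * i ≤ n) :
    √n / 64 ≤ 𝔼 σ : Equiv.Perm (Fin n), |permSum σ i| := by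
  have hs : 0 < √(n : ℝ) := Real.sqrt_pos.2 (by exact_mod_cast (by omega : 0 < n))
  have hsq : √(n : ℝ) ^ 2 = n := Real.sq_sqrt (by positivity)
  have hnR : (2 : ℝ) ≤ n := by exact_mod_cast hn2
  have hiR : (n : ℝ) ≤ 4 * i := by exact_mod_cast hi
  have hiR' : 2 * (i : ℝ) ≤ n := by exact_mod_cast hi'
  have h2 := expect_permSum_sq hn (show i ≤ n by omega)
  have h4 := expect_permSum_pow_four_le hn (show i ≤ n by omega)
  set A := 𝔼 σ : Equiv.Perm (Fin n), permSum σ i ^ 2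
  set B := 𝔼 σ : Equiv.Perm (Fin n), permSum σ i ^ 4
  have hA : (n : ℝ) / 8 ≤ A := by
    by_contra hc
    have : (n - 1) * A ≤ (n - 1) * ((n : ℝ) / 8) :=
      mul_le_mul_of_nonneg_left (not_le.1 hc).le (by linarith)
    nlinarith
  have hB : B ≤ 3 / 4 * (n : ℝ) ^ 2 := by nlinarith
  -- Pointwise `16 s² t² - t⁴ ≤ 64 s³ t` with `s = √n` and `t` the absolute partial sum; the cases
  -- `t ≤ 4s` and `t ≥ 4s` are separate.
  have h1 : 16 * n * A - B ≤ 64 * (n * √n) * 𝔼 σ : Equiv.Perm (Fin n), |permSum σ i| := by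
    rw [Finset.mul_expect, Finset.mul_expect, ← Finset.expect_sub_distrib]
    refine Finset.expect_le_expect fun σ _ => ?_
    set t := |permSum σ i|
    have ht : 0 ≤ t := abs_nonneg _
    have e2 : permSum σ i ^ 2 = t ^ 2 := (sq_abs _).symm
    have e4 : permSum σ i ^ 4 = t ^ 4 := by
      rw [show permSum σ i ^ 4 = (permSum σ i ^ 2) ^ 2 by ring, e2]; ring
    rw [e2, e4, ← hsq]
    set s := √(n : ℝ)
    rw [show √(s ^ 2) = s from Real.sqrt_sq hs.le]
    have : 0 ≤ t * ((4 * s) ^ 3 - (4 * s) ^ 2 * t + t ^ 3) := by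
      refine mul_nonneg ht ?_
      rcases le_total t (4 * s) with h | h
      · have : (4 * s) ^ 2 * t ≤ (4 * s) ^ 2 * (4 * s) := by gcongr
        nlinarith [pow_nonneg ht 3]
      · have : (4 * s) ^ 2 * t ≤ t ^ 2 * t := by gcongr
        nlinarith [pow_pos hs 3]
    nlinarith
  have h3 : 64 * (n * √n) * (√n / 64) = (n : ℝ) ^ 2 := by
    linear_combination (n : ℝ) * hsq
  have h5 : (n : ℝ) ^ 2 ≤ 16 * n * A - B := by nlinarith
  have h6 : 64 * (n * √n) * (√n / 64)
      ≤ 64 * (n * √n) * 𝔼 σ : Equiv.Perm (Fin n), |permSum σ i| := by linarith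
  exact le_of_mul_le_mul_left h6 (by positivity)

end Signs

/-! ### One epoch of the scalar iteration and its upward bias -/

section ScalarIterates

/-- The derivative of `x²/2` for `x ≥ 0` and `L x²/2` for `x < 0`. -/
def hinge (L t : ℝ) : ℝ := if 0 ≤ t then t else L * t

lemma hinge_one (t : ℝ) : hinge 1 t = t := by simp [hinge]

lemma hinge_eq_sub_max (L t : ℝ) : hinge L t = t - (L - 1) * max (-t) 0 := by
  unfold hinge
  split_ifs with h
  · rw [max_eq_right (by linarith)]; ring
  · rw [max_eq_left (by linarith)]; ring

lemma abs_hinge_le {L : ℝ} (hL : 1 ≤ L) (t : ℝ) : |hinge L t| ≤ L * |t| := by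
  unfold hinge
  split_ifs with h
  · nlinarith [abs_nonneg t]
  · rw [abs_mul, abs_of_nonneg (by linarith : 0 ≤ L)]

/-- As a maximum of two linear maps the step is convex, and it is increasing as soon as both slopes
are nonnegative, that is, for `α * L ≤ 1`. Both properties then pass to compositions of steps. -/
lemma sub_mul_hinge_eq_max {L α : ℝ} (hL : 1 ≤ L) (hα : 0 ≤ α) (t : ℝ) :
    t - α * hinge L t = max ((1 - α) * t) ((1 - α * L) * t) := by
  unfold hinge
  split_ifs with h
  · rw [max_eq_left]
    · ring
    · nlinarith [mul_nonneg (mul_nonneg hα (sub_nonneg.2 hL)) h]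
  · rw [max_eq_right]
    · ring
    · nlinarith [mul_nonneg (mul_nonneg hα (sub_nonneg.2 hL)) (neg_nonneg.2 (not_le.1 h).le)]

lemma sub_mul_hinge_monotone {L α : ℝ} (hL : 1 ≤ L) (hα : 0 ≤ α) (hαL : α * L ≤ 1) :
    Monotone fun t => t - α * hinge L t := by
  intro x y hxy
  have h1 : 0 ≤ 1 - α * L := by linarith
  have h2 : 0 ≤ 1 - α := by nlinarith
  simp only [sub_mul_hinge_eq_max hL hα]
  exact max_le_max (mul_le_mul_of_nonneg_left hxy h2) (mul_le_mul_of_nonneg_left hxy h1)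

lemma sub_mul_hinge_convex {L α : ℝ} (hL : 1 ≤ L) (hα : 0 ≤ α) {a b : ℝ} (ha : 0 ≤ a)
    (hb : 0 ≤ b) (x y : ℝ) :
    a * x + b * y - α * hinge L (a * x + b * y)
      ≤ a * (x - α * hinge L x) + b * (y - α * hinge L y) := by
  simp only [sub_mul_hinge_eq_max hL hα]
  refine max_le ?_ ?_
  · nlinarith [mul_le_mul_of_nonneg_left (le_max_left ((1 - α) * x) ((1 - α * L) * x)) ha,
      mul_le_mul_of_nonneg_left (le_max_left ((1 - α) * y) ((1 - α * L) * y)) hb]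
  · nlinarith [mul_le_mul_of_nonneg_left (le_max_right ((1 - α) * x) ((1 - α * L) * x)) ha,
      mul_le_mul_of_nonneg_left (le_max_right ((1 - α) * y) ((1 - α * L) * y)) hb]

/-- The scalar iterates `x ← x - α * hinge L x - R * s i` within an epoch. -/
def scalarIter (L α R : ℝ) (s : ℕ → ℝ) (x : ℝ) : ℕ → ℝ
  | 0 => x
  | i + 1 => scalarIter L α R s x i - α * hinge L (scalarIter L α R s x i) - R * s i

lemma scalarIter_monotone {L α : ℝ} (hL : 1 ≤ L) (hα : 0 ≤ α) (hαL : α * L ≤ 1) (R : ℝ)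
    (s : ℕ → ℝ) (i : ℕ) : Monotone fun x => scalarIter L α R s x i := by
  induction i with
  | zero => exact monotone_id
  | succ i ih =>
    intro x y hxy
    exact sub_le_sub_right (sub_mul_hinge_monotone hL hα hαL (ih hxy)) _

lemma scalarIter_convexOn {L α : ℝ} (hL : 1 ≤ L) (hα : 0 ≤ α) (hαL : α * L ≤ 1) (R : ℝ)
    (s : ℕ → ℝ) (i : ℕ) : ConvexOn ℝ Set.univ fun x => scalarIter L α R s x i := by
  refine ⟨convex_univ, fun x _ y _ a b ha hb hab => ?_⟩
  simp only [smul_eq_mul]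
  induction i with
  | zero => exact le_rfl
  | succ i ih =>
    have h1 := sub_mul_hinge_monotone hL hα hαL ih
    have h2 := sub_mul_hinge_convex hL hα ha hb (scalarIter L α R s x i) (scalarIter L α R s y i)
    have h3 : a * (R * s i) + b * (R * s i) = R * s i := by rw [← add_mul, hab, one_mul]
    simp only [scalarIter] at h1 ⊢
    linarith

lemma scalarIter_eq_sub_sum (L α R : ℝ) (s : ℕ → ℝ) (x : ℝ) (i : ℕ) :
    scalarIter L α R s x i = x - R * ∑ j ∈ Finset.range i, s j
      - α * ∑ j ∈ Finset.range i, hinge L (scalarIter L α R s x j) := by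
  induction i with
  | zero => simp [scalarIter]
  | succ i ih =>
    rw [scalarIter, Finset.sum_range_succ, Finset.sum_range_succ]
    linear_combination ih

lemma scalarIter_one (α R : ℝ) (s : ℕ → ℝ) (x : ℝ) (i : ℕ) :
    scalarIter 1 α R s x i = (1 - α) ^ i * x
      - R * ∑ j ∈ Finset.range i, (1 - α) ^ (i - 1 - j) * s j := by
  induction i with
  | zero => simp [scalarIter]
  | succ i ih =>
    rw [scalarIter, hinge_one, ih, Finset.sum_range_succ]
    have : ∑ j ∈ Finset.range i, (1 - α) ^ (i + 1 - 1 - j) * s j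
        = (1 - α) * ∑ j ∈ Finset.range i, (1 - α) ^ (i - 1 - j) * s j := by
      rw [Finset.mul_sum]
      refine Finset.sum_congr rfl fun j hj => ?_
      have := Finset.mem_range.1 hj
      rw [show i + 1 - 1 - j = (i - 1 - j) + 1 by omega, pow_succ]
      ring
    rw [this, show i + 1 - 1 - i = 0 by omega]
    ring

variable {n : ℕ}

/-- The mean of the scalar iterate after one epoch, as a function of the starting point. -/
def epochMean (n : ℕ) (L α R x : ℝ) : ℝ :=
  𝔼 σ : Equiv.Perm (Fin n), scalarIter L α R (permSign σ) x n

lemma epochMean_monotone {L α : ℝ} (hL : 1 ≤ L) (hα : 0 ≤ α) (hαL : α * L ≤ 1) (R : ℝ) :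
    Monotone (epochMean n L α R) := fun _ _ hxy =>
  Finset.expect_le_expect fun σ _ => scalarIter_monotone hL hα hαL R (permSign σ) n hxy

lemma epochMean_convexOn {L α : ℝ} (hL : 1 ≤ L) (hα : 0 ≤ α) (hαL : α * L ≤ 1) (R : ℝ) :
    ConvexOn ℝ Set.univ (epochMean n L α R) := by
  refine ⟨convex_univ, fun x _ y _ a b ha hb hab => ?_⟩
  simp only [smul_eq_mul, epochMean, Finset.mul_expect, ← Finset.expect_add_distrib]
  exact Finset.expect_le_expect fun σ _ =>
    (scalarIter_convexOn hL hα hαL R (permSign σ) n).2 trivial trivial ha hb hab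

/-- A discrete Gronwall argument: the accumulated gradients contribute at most `α * L * n ≤ 1 / 2`
times the claimed bound, so the factor `2` reproduces itself under strong induction. -/
lemma expect_abs_scalarIter_le (hn : 2 ∣ n) (hpos : 0 < n) {L α R x : ℝ} (hL : 1 ≤ L)
    (hα : 0 ≤ α) (hR : 0 ≤ R) (hx : 0 ≤ x) (hαL : α * L * n ≤ 1 / 2) {i : ℕ} (hi : i ≤ n) :
    𝔼 σ : Equiv.Perm (Fin n), |scalarIter L α R (permSign σ) x i| ≤ 2 * (R * √n + x) := by
  induction i using Nat.strong_induction_on with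
  | _ i ih =>
    have h1 : 𝔼 σ : Equiv.Perm (Fin n), |scalarIter L α R (permSign σ) x i|
        ≤ R * 𝔼 σ : Equiv.Perm (Fin n), |permSum σ i| + x + α * L *
          ∑ j ∈ Finset.range i, 𝔼 σ : Equiv.Perm (Fin n), |scalarIter L α R (permSign σ) x j| := by
      rw [← Finset.expect_sum_comm, Finset.mul_expect, Finset.mul_expect,
        ← Fintype.expect_const (ι := Equiv.Perm (Fin n)) x]
      simp only [← Finset.expect_add_distrib]
      rw [Fintype.expect_const]
      refine Finset.expect_le_expect fun σ _ => ?_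
      rw [scalarIter_eq_sub_sum]
      refine (abs_sub _ _).trans (add_le_add ((abs_sub _ _).trans ?_) ?_)
      · rw [abs_of_nonneg hx, abs_mul, abs_of_nonneg hR, add_comm]
        rfl
      · rw [abs_mul, abs_of_nonneg hα, mul_assoc, Finset.mul_sum]
        exact mul_le_mul_of_nonneg_left ((Finset.abs_sum_le_sum_abs _ _).trans
          (Finset.sum_le_sum fun j _ => abs_hinge_le hL _)) hα
    have h2 : ∑ j ∈ Finset.range i, 𝔼 σ : Equiv.Perm (Fin n), |scalarIter L α R (permSign σ) x j|
        ≤ n * (2 * (R * √n + x)) := by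
      calc _ ≤ ∑ j ∈ Finset.range i, 2 * (R * √n + x) := Finset.sum_le_sum fun j hj =>
            ih j (Finset.mem_range.1 hj) ((Finset.mem_range.1 hj).le.trans hi)
        _ = i * (2 * (R * √n + x)) := by simp
        _ ≤ _ := by gcongr
    have h3 := mul_le_mul_of_nonneg_left (expect_abs_permSum_le hn hpos hi) hR
    have h4 := mul_le_mul_of_nonneg_left h2 (by positivity : 0 ≤ α * L)
    have h5 : 0 ≤ R * √n + x := by positivity
    nlinarith

/-- Each sign has mean zero, so the noise drops out, and the kink enters the mean only through an
upward push by the negative part. -/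
lemma expect_scalarIter_succ (hn : 2 ∣ n) (L α R x : ℝ) {i : ℕ} (hi : i < n) :
    𝔼 σ : Equiv.Perm (Fin n), scalarIter L α R (permSign σ) x (i + 1)
      = (1 - α) * 𝔼 σ : Equiv.Perm (Fin n), scalarIter L α R (permSign σ) x i
        + α * (L - 1) * 𝔼 σ : Equiv.Perm (Fin n),
            max (-scalarIter L α R (permSign σ) x i) 0 := by
  have h := expect_permSign hn hi
  have h1 : ∀ σ : Equiv.Perm (Fin n), scalarIter L α R (permSign σ) x (i + 1)
      = (1 - α) * scalarIter L α R (permSign σ) x i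
        + α * (L - 1) * max (-scalarIter L α R (permSign σ) x i) 0 - R * permSign σ i := by
    intro σ
    rw [scalarIter, hinge_eq_sub_max]
    ring
  simp only [h1, Finset.expect_sub_distrib, Finset.expect_add_distrib, ← Finset.mul_expect, h]
  ring

lemma le_expect_scalarIter (hn : 2 ∣ n) {L α : ℝ} (hL : 1 ≤ L) (hα : 0 ≤ α) (hα1 : α ≤ 1)
    (R x : ℝ) {i : ℕ} (hi : i ≤ n) :
    (1 - α) ^ i * (x + α * (L - 1) * ∑ j ∈ Finset.range i, 𝔼 σ : Equiv.Perm (Fin n),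
        max (-scalarIter L α R (permSign σ) x j) 0)
      ≤ 𝔼 σ : Equiv.Perm (Fin n), scalarIter L α R (permSign σ) x i := by
  induction i with
  | zero => simp [scalarIter]
  | succ i ih =>
    rw [expect_scalarIter_succ hn L α R x (by omega), Finset.sum_range_succ]
    have h0 := mul_le_mul_of_nonneg_left (ih (by omega)) (by linarith : 0 ≤ 1 - α)
    set N := 𝔼 σ : Equiv.Perm (Fin n), max (-scalarIter L α R (permSign σ) x i) 0
    have hN : 0 ≤ N := Finset.expect_nonneg fun σ _ => le_max_right _ _
    have h1 : (1 - α) ^ (i + 1) * (α * (L - 1) * N) ≤ 1 * (α * (L - 1) * N) := by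
      have hc : 0 ≤ α * (L - 1) * N := mul_nonneg (mul_nonneg hα (by linarith)) hN
      exact mul_le_mul_of_nonneg_right (pow_le_one₀ (by linarith) (by linarith)) hc
    have h2 : ∀ S : ℝ, (1 - α) ^ (i + 1) * (x + α * (L - 1) * (S + N))
      = (1 - α) * ((1 - α) ^ i * (x + α * (L - 1) * S)) + (1 - α) ^ (i + 1) * (α * (L - 1) * N) := by
      intro S; ring
    rw [h2]
    linarith

/-- The expected negative part of the iterates in the second quarter of an epoch. -/
lemma le_expect_negPart_scalarIter (hn : 2 ∣ n) (hn2 : 2 ≤ n) {L α R : ℝ} (hL : 1 ≤ L)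
    (hα : 0 ≤ α) (hR : 0 ≤ R) (hαL : α * L * n ≤ 1 / 2048) {i : ℕ} (hi : n ≤ 4 * i)
    (hi' : 2 * i ≤ n) :
    R * √n / 256 ≤ 𝔼 σ : Equiv.Perm (Fin n),
      max (-scalarIter L α R (permSign σ) (R * √n / 1024) i) 0 := by
  set x := R * √n / 1024 with hxdef
  have hR' : 0 ≤ R * √n := by positivity
  have hx : 0 ≤ x := by positivity
  -- From `|S| + S = 2 * max S 0`: if the partial sum `S` is positive, `-y` is nearly `R * S` for
  -- the iterate `y`; otherwise the left side is at most `0`. The extra term in `S` has mean zero.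
  have h1 : R * 𝔼 σ : Equiv.Perm (Fin n), |permSum σ i| - 2 * x - 2 * (α * L *
          ∑ j ∈ Finset.range i, 𝔼 σ : Equiv.Perm (Fin n), |scalarIter L α R (permSign σ) x j|)
      + R * 𝔼 σ : Equiv.Perm (Fin n), permSum σ i
      ≤ 2 * 𝔼 σ : Equiv.Perm (Fin n), max (-scalarIter L α R (permSign σ) x i) 0 := by
    rw [← Finset.expect_sum_comm]
    simp only [Finset.mul_expect]
    rw [← Fintype.expect_const (ι := Equiv.Perm (Fin n)) x, Finset.mul_expect]
    simp only [← Finset.expect_add_distrib, ← Finset.expect_sub_distrib]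
    refine Finset.expect_le_expect fun σ _ => ?_
    rw [Fintype.expect_const]
    have e := scalarIter_eq_sub_sum L α R (permSign σ) x i
    have hb : |α * ∑ j ∈ Finset.range i, hinge L (scalarIter L α R (permSign σ) x j)|
        ≤ α * L * ∑ j ∈ Finset.range i, |scalarIter L α R (permSign σ) x j| := by
      rw [abs_mul, abs_of_nonneg hα, mul_assoc, Finset.mul_sum]
      exact mul_le_mul_of_nonneg_left ((Finset.abs_sum_le_sum_abs _ _).trans
        (Finset.sum_le_sum fun j _ => abs_hinge_le hL _)) hα
    have hb' := abs_le.1 hb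
    change _ = x - R * permSum σ i - _ at e
    have m1 := le_max_left (-scalarIter L α R (permSign σ) x i) 0
    have m2 := le_max_right (-scalarIter L α R (permSign σ) x i) 0
    rcases le_total 0 (permSum σ i) with hs | hs
    · rw [abs_of_nonneg hs]
      linarith
    · rw [abs_of_nonpos hs]
      have : 0 ≤ R * (-permSum σ i) := mul_nonneg hR (by linarith)
      have := (abs_nonneg _).trans hb
      linarith
  rw [expect_permSum hn (by omega)] at h1
  have h2 : ∑ j ∈ Finset.range i, 𝔼 σ : Equiv.Perm (Fin n), |scalarIter L α R (permSign σ) x j|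
      ≤ n * (2 * (R * √n + x)) := by
    calc _ ≤ ∑ j ∈ Finset.range i, 2 * (R * √n + x) := Finset.sum_le_sum fun j hj =>
          expect_abs_scalarIter_le hn (by omega) hL hα hR hx (by linarith)
            (by have := Finset.mem_range.1 hj; omega)
      _ = i * (2 * (R * √n + x)) := by simp
      _ ≤ _ := by
        have : (i : ℝ) ≤ n := by exact_mod_cast (by omega : i ≤ n)
        gcongr
  have h3 := mul_le_mul_of_nonneg_left (le_expect_abs_permSum hn hn2 hi hi') hR
  have h4 := mul_le_mul_of_nonneg_left h2 (by positivity : 0 ≤ α * L)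
  have h5 : α * L * n * (2 * (R * √n + x)) ≤ 1 / 2048 * (2 * (R * √n + x)) := by
    gcongr
  linarith

/-- The upward push gathered over the second quarter of the epoch outweighs the contraction `(1 - α)
^ n ≥ 1 - n * α` of the mean. -/
lemma le_epochMean (hn : 4 ∣ n) (hn2 : 2 ≤ n) {L α R : ℝ} (hL : 9 ≤ L)
    (hα : 0 ≤ α) (hR : 0 ≤ R) (hαL : α * L * n ≤ 1 / 2048) :
    R * √n / 1024 ≤ epochMean n L α R (R * √n / 1024) := by
  have h2n : 2 ∣ n := dvd_trans (by norm_num) hn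
  have hnR : (2 : ℝ) ≤ n := by exact_mod_cast hn2
  have hαn : α * n ≤ 1 / 2048 := by
    have : α * n * 1 ≤ α * n * L := by gcongr; linarith
    linarith
  have hα1 : α ≤ 1 := by nlinarith
  have h := le_expect_scalarIter h2n (by linarith : 1 ≤ L) hα hα1 R (R * √n / 1024) le_rfl
  have hB : 1 - n * α ≤ (1 - α) ^ n := by
    have := one_add_mul_le_pow (show (-2 : ℝ) ≤ -α by linarith) n
    rw [← sub_eq_add_neg] at this
    linarith
  set x := R * √n / 1024 with hxdef
  have hx : 0 ≤ x := by positivity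
  set S := ∑ j ∈ Finset.range n, 𝔼 σ : Equiv.Perm (Fin n),
    max (-scalarIter L α R (permSign σ) x j) 0 with hS
  have hSle : n * x ≤ S := by
    obtain ⟨m, rfl⟩ := hn
    -- There are `n / 4` indices in the second quarter, each contributing at least `R * √n / 256 = 4
    -- * x`.
    calc ((4 * m : ℕ) : ℝ) * x = ∑ j ∈ Finset.Ico m (2 * m), R * √((4 * m : ℕ) : ℝ) / 256 := by
          rw [Finset.sum_const, Nat.card_Ico, nsmul_eq_mul, hxdef, show 2 * m - m = m by omega]
          push_cast
          ring
      _ ≤ ∑ j ∈ Finset.Ico m (2 * m), 𝔼 σ : Equiv.Perm (Fin (4 * m)),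
            max (-scalarIter L α R (permSign σ) x j) 0 := by
          refine Finset.sum_le_sum fun j hj => ?_
          rw [Finset.mem_Ico] at hj
          exact le_expect_negPart_scalarIter h2n hn2 (by linarith) hα hR hαL (by omega) (by omega)
      _ ≤ S := by
          refine Finset.sum_le_sum_of_subset_of_nonneg (fun j hj => ?_)
            fun j _ _ => Finset.expect_nonneg fun σ _ => le_max_right _ _
          rw [Finset.mem_Ico] at hj
          rw [Finset.mem_range]
          omega
  have hS0 : 0 ≤ S := le_trans (by positivity) hSle
  refine le_trans ?_ h
  have h1 : x + α * 8 * S ≤ x + α * (L - 1) * S := by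
    gcongr
    linarith
  calc x ≤ (1 - n * α) * (x + α * 8 * S) := by
        have hA : 0 ≤ α * (S - n * x) := mul_nonneg hα (by linarith)
        have hB : 0 ≤ α * S * (1 - n * α) := by
          have : 0 ≤ 1 - n * α := by linarith
          positivity
        have hC : 0 ≤ α * S * (1 / 2 - n * α) := by
          have : 0 ≤ 1 / 2 - n * α := by linarith
          positivity
        nlinarith
    _ ≤ (1 - α) ^ n * (x + α * (L - 1) * S) := by
        refine mul_le_mul hB h1 ?_ ?_
        · positivity
        · exact pow_nonneg (by linarith) _

end ScalarIterates

/-! ### Variance created by one epoch on the quadratic -/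

section Variance

variable {n : ℕ}

lemma expect_permSign_mul_permSign (hn : 2 ∣ n) {i j : ℕ} (hi : i < n) (hj : j < n)
    (hij : i ≠ j) :
    ((n : ℝ) - 1) * 𝔼 σ : Equiv.Perm (Fin n), permSign σ i * permSign σ j = -1 := by
  have h0 : 𝔼 σ : Equiv.Perm (Fin n), ∑ k ∈ Finset.range n, permSign σ i * permSign σ k = 0 := by
    refine Finset.expect_eq_zero fun σ _ => ?_
    rw [← Finset.mul_sum]
    exact mul_eq_zero_of_right _ (permSum_self hn σ)
  rw [Finset.expect_sum_comm, ← Finset.add_sum_erase _ _ (Finset.mem_range.2 hi)] at h0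
  have h1 : 𝔼 σ : Equiv.Perm (Fin n), permSign σ i * permSign σ i = 1 := by
    rw [← Fintype.expect_const (ι := Equiv.Perm (Fin n)) (1 : ℝ)]
    exact Finset.expect_congr rfl fun σ _ => by rw [← sq, permSign_sq σ hi]
  have h2 : ∀ k ∈ (Finset.range n).erase i,
      𝔼 σ : Equiv.Perm (Fin n), permSign σ i * permSign σ k
        = 𝔼 σ : Equiv.Perm (Fin n), permSign σ i * permSign σ j := by
    intro k hk
    rw [Finset.mem_erase, Finset.mem_range] at hk
    rcases eq_or_ne k j with rfl | hkj
    · rfl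
    · exact expect_mul_permSign_swap _ hj hk.2 fun σ =>
        permSign_mul_swap_of_ne σ hj hk.2 hij (Ne.symm hk.1)
  rw [h1, Finset.sum_congr rfl h2, Finset.sum_const, Finset.card_erase_of_mem
    (Finset.mem_range.2 hi), Finset.card_range, nsmul_eq_mul, Nat.cast_sub (by omega)] at h0
  push_cast at h0
  linarith

lemma expect_sum_mul_permSign (hn : 2 ∣ n) (a : ℕ → ℝ) :
    𝔼 σ : Equiv.Perm (Fin n), ∑ j ∈ Finset.range n, a j * permSign σ j = 0 := by
  rw [Finset.expect_sum_comm]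
  refine Finset.sum_eq_zero fun j hj => ?_
  rw [← Finset.mul_expect, expect_permSign hn (Finset.mem_range.1 hj), mul_zero]

/-- Sampling without replacement: the second moment of a weighted sum of the signs dominates the
total squared deviation of the weights from some centre. -/
lemma exists_sum_sq_sub_le_expect_sq (hn : 2 ∣ n) (hn2 : 2 ≤ n) (a : ℕ → ℝ) :
    ∃ m : ℝ, ∑ j ∈ Finset.range n, (a j - m) ^ 2
      ≤ 𝔼 σ : Equiv.Perm (Fin n), (∑ j ∈ Finset.range n, a j * permSign σ j) ^ 2 := by
  have hnR : (2 : ℝ) ≤ n := by exact_mod_cast hn2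
  set A := ∑ j ∈ Finset.range n, a j with hA
  set Q := ∑ j ∈ Finset.range n, a j ^ 2 with hQ
  -- The centre is the mean weight; the second moment is exactly `n / (n - 1)` times the total
  -- squared deviation from it.
  refine ⟨A / n, ?_⟩
  have h1 : ((n : ℝ) - 1) *
      𝔼 σ : Equiv.Perm (Fin n), (∑ j ∈ Finset.range n, a j * permSign σ j) ^ 2
      = n * Q - A ^ 2 := by
    have e : ∀ i ∈ Finset.range n, ∀ j ∈ Finset.range n, ((n : ℝ) - 1) *
        𝔼 σ : Equiv.Perm (Fin n), (a i * permSign σ i) * (a j * permSign σ j)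
        = (if i = j then n * a i ^ 2 else 0) - a i * a j := by
      intro i hi j hj
      rw [Finset.mem_range] at hi hj
      have : 𝔼 σ : Equiv.Perm (Fin n), (a i * permSign σ i) * (a j * permSign σ j)
          = a i * a j * 𝔼 σ : Equiv.Perm (Fin n), permSign σ i * permSign σ j := by
        rw [Finset.mul_expect]
        exact Finset.expect_congr rfl fun σ _ => by ring
      rw [this]
      split_ifs with h
      · subst h
        have h1 : 𝔼 σ : Equiv.Perm (Fin n), permSign σ i * permSign σ i = 1 := by
          rw [← Fintype.expect_const (ι := Equiv.Perm (Fin n)) (1 : ℝ)]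
          exact Finset.expect_congr rfl fun σ _ => by rw [← sq, permSign_sq σ hi]
        rw [h1]; ring
      · linear_combination a i * a j * expect_permSign_mul_permSign hn hi hj h
    simp only [sq (∑ j ∈ Finset.range n, a j * permSign _ j), Finset.sum_mul_sum]
    rw [Finset.expect_sum_comm, Finset.mul_sum, sq A, hA, Finset.sum_mul_sum, hQ, Finset.mul_sum,
      ← Finset.sum_sub_distrib]
    refine Finset.sum_congr rfl fun i hi => ?_
    rw [Finset.expect_sum_comm, Finset.mul_sum, Finset.sum_congr rfl (e i hi),
      Finset.sum_sub_distrib, Finset.sum_ite_eq, if_pos hi]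
  have h2 : ∑ j ∈ Finset.range n, (a j - A / n) ^ 2 = Q - A ^ 2 / n := by
    have : ∀ j ∈ Finset.range n, (a j - A / n) ^ 2
        = a j ^ 2 - 2 * (A / n) * a j + (A / n) ^ 2 := fun j _ => by ring
    rw [Finset.sum_congr rfl this, Finset.sum_add_distrib, Finset.sum_sub_distrib,
      ← Finset.mul_sum, Finset.sum_const, Finset.card_range, nsmul_eq_mul, ← hA]
    field_simp
    ring
  have h3 : 0 ≤ Q - A ^ 2 / n := h2 ▸ Finset.sum_nonneg fun j _ => sq_nonneg _
  rw [h2]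
  refine le_of_mul_le_mul_left ?_ (show (0 : ℝ) < n - 1 by linarith)
  rw [h1]
  have : (n : ℝ) * (Q - A ^ 2 / n) = n * Q - A ^ 2 := by field_simp
  rw [← this]
  nlinarith

/-- Two weights that differ by `d` have total squared deviation at least `d² / 2` from any centre.
For `α ≥ 1` the first two weights suffice; for `α ≤ 1` weight `k` is paired with weight `k + n / 2`.
-/
lemma le_sq_mul_sum_pow_sub_sq (hn : 2 ∣ n) (hn2 : 2 ≤ n) {c α : ℝ} (hc : 0 < c) (hc1 : c ≤ 1)
    (hα : c / n ≤ α) (m : ℝ) :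
    c ^ 4 / 256 / n ≤ α ^ 2 * ∑ k ∈ Finset.range n, ((1 - α) ^ k - m) ^ 2 := by
  have hnR : (2 : ℝ) ≤ n := by exact_mod_cast hn2
  have hα0 : 0 < α := lt_of_lt_of_le (by positivity) hα
  rcases le_total 1 α with h1 | h1
  · have h2 : α ^ 2 / 2 ≤ ∑ k ∈ Finset.range n, ((1 - α) ^ k - m) ^ 2 := by
      calc α ^ 2 / 2 ≤ ∑ k ∈ Finset.range 2, ((1 - α) ^ k - m) ^ 2 := by
            simp only [Finset.sum_range_succ, Finset.sum_range_zero, pow_zero, pow_one, zero_add]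
            nlinarith [sq_nonneg ((1 - m) + (1 - α - m))]
        _ ≤ _ := Finset.sum_le_sum_of_subset_of_nonneg (Finset.range_mono hn2)
            fun _ _ _ => sq_nonneg _
    have h3 : (1 : ℝ) ≤ α ^ 2 := one_le_pow₀ h1
    have h4 : c ^ 4 ≤ 1 := pow_le_one₀ hc.le hc1
    calc c ^ 4 / 256 / n ≤ 1 / 256 / 2 := by gcongr
      _ ≤ 1 * (1 / 2) := by norm_num
      _ ≤ α ^ 2 * (α ^ 2 / 2) := by gcongr
      _ ≤ _ := by gcongr
  · obtain ⟨p, rfl⟩ := hn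
    have hq : 0 ≤ 1 - α := by linarith
    set q := 1 - α with hqdef
    have hqp : 0 ≤ q ^ p := pow_nonneg hq _
    have hqp1 : q ^ p ≤ 1 := pow_le_one₀ hq (by linarith)
    have hpα : c / 2 ≤ p * α := by
      rw [div_le_iff₀ (by linarith)] at hα
      push_cast at hα
      linarith
    -- Since `(1 - α) * (1 + α) ≤ 1`, Bernoulli gives `q ^ p ≤ 1 / (1 + p * α)`, and `p * α ≥ c /
    -- 2`.
    have hδ : c / 4 ≤ 1 - q ^ p := by
      have e1 : 1 + p * α ≤ (1 + α) ^ p := one_add_mul_le_pow (by linarith) p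
      have e2 : q ^ p * (1 + α) ^ p ≤ 1 := by
        rw [← mul_pow]
        refine pow_le_one₀ (by positivity) ?_
        rw [hqdef]; nlinarith
      nlinarith
    have h2 : ∑ k ∈ Finset.range p, q ^ (2 * k) * (1 - q ^ p) ^ 2
        ≤ 2 * ∑ k ∈ Finset.range (2 * p), (q ^ k - m) ^ 2 := by
      rw [two_mul p, Finset.sum_range_add, ← Finset.sum_add_distrib, Finset.mul_sum]
      refine Finset.sum_le_sum fun k _ => ?_
      rw [show q ^ (2 * k) * (1 - q ^ p) ^ 2 = (q ^ k - q ^ (p + k)) ^ 2 by ring]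
      nlinarith [sq_nonneg ((q ^ k - m) + (q ^ (p + k) - m))]
    have h3 : (∑ k ∈ Finset.range p, q ^ (2 * k)) * (α * (1 + q)) = (1 - q ^ p) * (1 + q ^ p) := by
      have := geom_sum_mul (q ^ 2) p
      simp only [← pow_mul] at this
      rw [hqdef] at this ⊢
      linear_combination -this
    rw [← Finset.sum_mul] at h2
    set S := ∑ k ∈ Finset.range p, q ^ (2 * k) with hS
    have hS0 : 0 ≤ S := Finset.sum_nonneg fun k _ => pow_nonneg hq _
    have h4 : (1 - q ^ p) / 2 ≤ S * α := by
      have : S * α * (1 + q) ≤ S * α * 2 := by gcongr; linarith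
      nlinarith
    have hδ0 : 0 ≤ 1 - q ^ p := by linarith
    calc c ^ 4 / 256 / ((2 * p : ℕ) : ℝ) = (c / ((2 * p : ℕ) : ℝ)) * (c / 4) ^ 3 / 4 := by ring
      _ ≤ α * (1 - q ^ p) ^ 3 / 4 := by gcongr
      _ = α * ((1 - q ^ p) / 2) * (1 - q ^ p) ^ 2 / 2 := by ring
      _ ≤ α * (S * α) * (1 - q ^ p) ^ 2 / 2 := by gcongr
      _ = α ^ 2 * (S * (1 - q ^ p) ^ 2 / 2) := by ring
      _ ≤ _ := by gcongr; linarith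

/-- One epoch on the quadratic creates variance, whatever the starting point. -/
lemma le_expect_scalarIter_one_sq (hn : 2 ∣ n) (hn2 : 2 ≤ n) {c α : ℝ} (hc : 0 < c) (hc1 : c ≤ 1)
    (hα : c / n ≤ α) (G x : ℝ) :
    G ^ 2 / 4 * (c ^ 4 / 256 / n)
      ≤ 𝔼 σ : Equiv.Perm (Fin n), scalarIter 1 α (α * G / 2) (permSign σ) x n ^ 2 := by
  set R := α * G / 2 with hR
  obtain ⟨m, hm⟩ := exists_sum_sq_sub_le_expect_sq hn hn2 fun j => (1 - α) ^ (n - 1 - j)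
  rw [Finset.sum_range_reflect (fun k => ((1 - α) ^ k - m) ^ 2)] at hm
  have h1 := le_sq_mul_sum_pow_sub_sq hn hn2 hc hc1 hα m
  have h2 : 𝔼 σ : Equiv.Perm (Fin n), scalarIter 1 α R (permSign σ) x n ^ 2
      = ((1 - α) ^ n * x) ^ 2 + R ^ 2 * 𝔼 σ : Equiv.Perm (Fin n),
        (∑ j ∈ Finset.range n, (1 - α) ^ (n - 1 - j) * permSign σ j) ^ 2
        - 2 * ((1 - α) ^ n * x) * R * 𝔼 σ : Equiv.Perm (Fin n),
        ∑ j ∈ Finset.range n, (1 - α) ^ (n - 1 - j) * permSign σ j := by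
    rw [Finset.mul_expect, Finset.mul_expect,
      ← Fintype.expect_const (ι := Equiv.Perm (Fin n)) (((1 - α) ^ n * x) ^ 2),
      ← Finset.expect_add_distrib, ← Finset.expect_sub_distrib]
    refine Finset.expect_congr rfl fun σ _ => ?_
    rw [scalarIter_one]
    ring
  rw [h2, expect_sum_mul_permSign hn]
  calc G ^ 2 / 4 * (c ^ 4 / 256 / n)
      ≤ G ^ 2 / 4 * (α ^ 2 * ∑ k ∈ Finset.range n, ((1 - α) ^ k - m) ^ 2) := by gcongr
    _ = R ^ 2 * ∑ k ∈ Finset.range n, ((1 - α) ^ k - m) ^ 2 := by rw [hR]; ring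
    _ ≤ R ^ 2 * 𝔼 σ : Equiv.Perm (Fin n),
        (∑ j ∈ Finset.range n, (1 - α) ^ (n - 1 - j) * permSign σ j) ^ 2 := by gcongr
    _ ≤ _ := by nlinarith [sq_nonneg ((1 - α) ^ n * x)]

end Variance

/-! ### Iterating over epochs and the three step-size regimes -/

section Epochs

variable {n : ℕ}

lemma ConvexOn.map_expect_le {ι : Type*} [Fintype ι] [Nonempty ι] {φ : ℝ → ℝ}
    (hφ : ConvexOn ℝ Set.univ φ) (g : ι → ℝ) : φ (𝔼 i, g i) ≤ 𝔼 i, φ (g i) := by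
  have h := hφ.map_sum_le (t := Finset.univ) (w := fun _ : ι => (1 : ℝ) / Fintype.card ι) (p := g)
    (fun _ _ => by positivity) (by simp) (fun _ _ => trivial)
  simp only [smul_eq_mul, one_div_mul_eq_div, ← Finset.sum_div] at h
  rwa [Fintype.expect_eq_sum_div_card, Fintype.expect_eq_sum_div_card]

lemma sq_expect_le {ι : Type*} [Fintype ι] [Nonempty ι] (g : ι → ℝ) :
    (𝔼 i, g i) ^ 2 ≤ 𝔼 i, g i ^ 2 :=
  ConvexOn.map_expect_le even_two.convexOn_pow g

lemma expect_fin_succ {P : Type*} [Fintype P] (K : ℕ) (φ : (Fin (K + 1) → P) → ℝ) :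
    𝔼 τ : Fin (K + 1) → P, φ τ
      = 𝔼 τ : Fin K → P, 𝔼 σ : P, φ (Fin.snoc (α := fun _ => P) τ σ) := by
  rw [Finset.expect_comm, ← Finset.expect_product', Finset.univ_product_univ]
  refine (Fintype.expect_equiv (Fin.snocEquiv fun _ => P) _ _ fun p => ?_).symm
  rfl

lemma Fin.map_foldl {β γ : Type*} (π : β → γ) {m : ℕ} (f : β → Fin m → β) (g : γ → Fin m → γ)
    (h : ∀ y i, π (f y i) = g (π y) i) (x : β) : π (Fin.foldl m f x) = Fin.foldl m g (π x) := by
  induction m with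
  | zero => simp
  | succ m ih =>
    rw [Fin.foldl_succ_last, Fin.foldl_succ_last, h,
      ih (fun y i => f y i.castSucc) (fun y i => g y i.castSucc) fun y i => h y _]

lemma Fin.foldl_eq_of_succ {β : Type*} {m : ℕ} (f : β → Fin m → β) (x : β) (z : ℕ → β)
    (h0 : z 0 = x) (hs : ∀ i : Fin m, z (i + 1) = f (z i) i) : Fin.foldl m f x = z m := by
  induction m with
  | zero => simp [h0]
  | succ m ih =>
    rw [Fin.foldl_succ_last, ih (fun y i => f y i.castSucc) fun i => hs i.castSucc]
    exact (hs (Fin.last m)).symm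

/-- The scalar iterate after `K` epochs. -/
def scalarLast (L α R x : ℝ) {K : ℕ} (τ : Fin K → Equiv.Perm (Fin n)) : ℝ :=
  Fin.foldl K (fun y j => scalarIter L α R (permSign (τ j)) y n) x

lemma scalarLast_snoc (L α R x : ℝ) {K : ℕ} (τ : Fin K → Equiv.Perm (Fin n))
    (σ : Equiv.Perm (Fin n)) :
    scalarLast L α R x (Fin.snoc (α := fun _ => Equiv.Perm (Fin n)) τ σ : Fin (K + 1) → _)
      = scalarIter L α R (permSign σ) (scalarLast L α R x τ) n := by
  unfold scalarLast
  rw [Fin.foldl_succ_last]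
  simp only [Fin.snoc_castSucc, Fin.snoc_last]

lemma expect_scalarLast_succ (L α R x : ℝ) (K : ℕ) :
    𝔼 τ : Fin (K + 1) → Equiv.Perm (Fin n), scalarLast L α R x τ
      = 𝔼 τ : Fin K → Equiv.Perm (Fin n), epochMean n L α R (scalarLast L α R x τ) := by
  rw [expect_fin_succ]
  simp only [scalarLast_snoc, epochMean]

/-- With `M` the epoch mean and `X` the iterate after `K` epochs, the next mean is `𝔼 M(X) ≥ M(𝔼 X)
≥ M(θ) ≥ θ`, by convexity, monotonicity and `hθ` in turn. -/
lemma le_expect_scalarLast {L α R θ x : ℝ} (hL : 1 ≤ L) (hα : 0 ≤ α) (hαL : α * L ≤ 1)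
    (hθ : θ ≤ epochMean n L α R θ) (hx : θ ≤ x) (K : ℕ) :
    θ ≤ 𝔼 τ : Fin K → Equiv.Perm (Fin n), scalarLast L α R x τ := by
  induction K with
  | zero => simpa [scalarLast] using hx
  | succ K ih =>
    rw [expect_scalarLast_succ]
    exact hθ.trans ((epochMean_monotone hL hα hαL R ih).trans
      ((epochMean_convexOn hL hα hαL R).map_expect_le _))

lemma epochMean_one (hn : 2 ∣ n) (α R x : ℝ) : epochMean n 1 α R x = (1 - α) ^ n * x := by
  simp only [epochMean, scalarIter_one, Finset.expect_sub_distrib, Fintype.expect_const,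
    ← Finset.mul_expect, expect_sum_mul_permSign hn, mul_zero, sub_zero]

lemma expect_scalarLast_one (hn : 2 ∣ n) (α R x : ℝ) (K : ℕ) :
    𝔼 τ : Fin K → Equiv.Perm (Fin n), scalarLast 1 α R x τ = (1 - α) ^ (n * K) * x := by
  induction K with
  | zero => simp [scalarLast]
  | succ K ih =>
    simp only [expect_scalarLast_succ, epochMean_one hn, ← Finset.mul_expect, ih]
    ring

/-- Conditioning on the earlier epochs is harmless because the one-epoch bound is uniform in the
starting point. -/
lemma le_expect_scalarLast_one_sq (hn : 2 ∣ n) (hn2 : 2 ≤ n) {c α : ℝ} (hc : 0 < c) (hc1 : c ≤ 1)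
    (hα : c / n ≤ α) (G x : ℝ) (K : ℕ) :
    G ^ 2 / 4 * (c ^ 4 / 256 / n)
      ≤ 𝔼 τ : Fin (K + 1) → Equiv.Perm (Fin n), scalarLast 1 α (α * G / 2) x τ ^ 2 := by
  rw [expect_fin_succ]
  simp only [scalarLast_snoc]
  rw [← Fintype.expect_const (ι := Fin K → Equiv.Perm (Fin n)) (G ^ 2 / 4 * (c ^ 4 / 256 / n))]
  exact Finset.expect_le_expect fun τ _ => le_expect_scalarIter_one_sq hn hn2 hc hc1 hα G _

/-- The lower bound for the two coordinates together, with the three regimes of the step size. -/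
lemma le_expect_scalarLast_sq_add_sq (hn : 4 ∣ n) (hn2 : 2 ≤ n) {G α : ℝ} (hG : 0 < G) (hα : 0 < α)
    {K : ℕ} (hK : 1 ≤ K) :
    (1 / 2 ^ 128) * G ^ 2 * n / (n * K) ^ 2
      ≤ 𝔼 τ : Fin K → Equiv.Perm (Fin n),
        (scalarLast (2 ^ 17) α (α * G / 2) (G / 2) τ ^ 2
          + scalarLast 1 α (α * G / 2) (G / 2) τ ^ 2) := by
  have h2n : 2 ∣ n := dvd_trans (by norm_num) hn
  have hnR : (2 : ℝ) ≤ n := by exact_mod_cast hn2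
  have hKR : (1 : ℝ) ≤ K := by exact_mod_cast hK
  rw [Finset.expect_add_distrib]
  set X := 𝔼 τ : Fin K → Equiv.Perm (Fin n), scalarLast (2 ^ 17) α (α * G / 2) (G / 2) τ ^ 2
    with hXdef
  set Y := 𝔼 τ : Fin K → Equiv.Perm (Fin n), scalarLast 1 α (α * G / 2) (G / 2) τ ^ 2 with hYdef
  have hX0 : 0 ≤ X := Finset.expect_nonneg fun _ _ => sq_nonneg _
  have hY0 : 0 ≤ Y := Finset.expect_nonneg fun _ _ => sq_nonneg _
  have hT : (2 : ℝ) ≤ n * K := by nlinarith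
  have hnT : (n : ℝ) ≤ (n * K) ^ 2 := by nlinarith
  -- Below this threshold `α * L * n ≤ 2 ^ 17 / 2 ^ 28 = 1 / 2048`, as `le_epochMean` requires.
  rcases le_total ((1 / 2 ^ 28 : ℝ) / n) α with hbig | hsmall
  · obtain ⟨k, rfl⟩ : ∃ k, K = k + 1 := ⟨K - 1, by omega⟩
    have h := le_expect_scalarLast_one_sq h2n hn2 (by norm_num : (0 : ℝ) < 1 / 2 ^ 28)
      (by norm_num) hbig G (G / 2) k
    rw [← hYdef] at h
    refine (le_trans ?_ h).trans (le_add_of_nonneg_left hX0)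
    set κ : ℝ := ((k + 1 : ℕ) : ℝ)
    calc 1 / 2 ^ 128 * G ^ 2 * n / (n * κ) ^ 2 = 1 / 2 ^ 128 * G ^ 2 / n * (1 / κ ^ 2) := by
          field_simp
      _ ≤ 1 / 2 ^ 128 * G ^ 2 / n * 1 := by
          gcongr
          rw [div_le_one (by positivity)]
          exact one_le_pow₀ hKR
      _ ≤ G ^ 2 / 4 * ((1 / 2 ^ 28) ^ 4 / 256 / n) := by
          rw [show G ^ 2 / 4 * (((1 : ℝ) / 2 ^ 28) ^ 4 / 256 / n) = 1 / 2 ^ 122 * G ^ 2 / n by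
            norm_num; ring, mul_one]
          gcongr <;> norm_num
  -- For the smaller steps Bernoulli keeps half of the initial mean; for the larger ones `α` exceeds
  -- `1 / (2T)`, so `θ²` has the required order.
  · rcases le_total α (1 / (2 * (n * K))) with hα1 | hα1
    · have h := sq_expect_le fun τ : Fin K → Equiv.Perm (Fin n) =>
        scalarLast 1 α (α * G / 2) (G / 2) τ
      rw [expect_scalarLast_one h2n] at h
      have hα2 : n * K * α ≤ 1 / 2 := by
        rw [le_div_iff₀ (by positivity)] at hα1
        linarith
      have hp : 1 / 2 ≤ (1 - α) ^ (n * K) := by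
        have := one_add_mul_le_pow (show (-2 : ℝ) ≤ -α by nlinarith) (n * K)
        rw [← sub_eq_add_neg] at this
        push_cast at this
        linarith
      refine (le_trans ?_ h).trans (le_add_of_nonneg_left hX0)
      calc 1 / 2 ^ 128 * G ^ 2 * n / (n * K) ^ 2 = 1 / 2 ^ 128 * G ^ 2 * (n / (n * K) ^ 2) := by ring
        _ ≤ 1 / 2 ^ 128 * G ^ 2 * 1 := by
          gcongr
          exact div_le_one_of_le₀ hnT (by positivity)
        _ ≤ (1 / 2 * (G / 2)) ^ 2 := by nlinarith [sq_nonneg G]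
        _ ≤ _ := by gcongr
    · have hs : 0 ≤ √(n : ℝ) := Real.sqrt_nonneg _
      have hsq : √(n : ℝ) ^ 2 = n := Real.sq_sqrt (by positivity)
      have hαn : α * n ≤ 1 / 2 ^ 28 := by rwa [le_div_iff₀ (by linarith)] at hsmall
      have hsn : √(n : ℝ) ≤ n := by
        rw [Real.sqrt_le_left (by positivity)]
        nlinarith
      have hθ := le_epochMean (n := n) (L := 2 ^ 17) (α := α) (R := α * G / 2) hn hn2 (by norm_num)
        hα.le (by positivity) (by linarith)
      have hθx : α * G / 2 * √n / 1024 ≤ G / 2 := by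
        have : α * √n ≤ 1 := by nlinarith
        nlinarith
      have h1 := le_expect_scalarLast (by norm_num) hα.le (by nlinarith) hθ hθx K
      have h := sq_expect_le fun τ : Fin K → Equiv.Perm (Fin n) =>
        scalarLast (2 ^ 17) α (α * G / 2) (G / 2) τ
      refine (le_trans ?_ h).trans (le_add_of_nonneg_right hY0)
      calc 1 / 2 ^ 128 * G ^ 2 * n / (n * K) ^ 2
          = 1 / 2 ^ 126 * G ^ 2 * n * (1 / (2 * (n * K))) ^ 2 := by
            field_simp
        _ ≤ 1 / 2 ^ 126 * G ^ 2 * n * α ^ 2 := by gcongr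
        _ ≤ 1 / 2 ^ 22 * G ^ 2 * n * α ^ 2 := by gcongr <;> norm_num
        _ = (α * G / 2 * √n / 1024) ^ 2 := by
            rw [div_pow, mul_pow, hsq]
            ring
        _ ≤ _ := by gcongr

end Epochs

/-! ### The planar components: calculus, invariant rectangle, reduction to coordinates -/

section PlaneComponents

lemma hasDerivAt_min_zero_sq (t : ℝ) : HasDerivAt (fun u : ℝ => min u 0 ^ 2) (2 * min t 0) t := by
  rcases lt_trichotomy t 0 with h | rfl | h
  · rw [min_eq_left h.le]
    refine (by simpa using hasDerivAt_pow 2 t : HasDerivAt (fun u : ℝ => u ^ 2) (2 * t) t).congr_of_eventuallyEq ?_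
    filter_upwards [Iio_mem_nhds h] with u hu
    rw [min_eq_left (le_of_lt hu)]
  · have hO : (fun u : ℝ => min u 0 ^ 2) =O[nhds 0] fun u => ‖u - 0‖ ^ 2 := by
      refine Asymptotics.IsBigO.of_bound 1 (Filter.Eventually.of_forall fun u => ?_)
      rw [sub_zero, norm_pow, norm_pow, one_mul, norm_norm]
      refine pow_le_pow_left₀ (norm_nonneg _) ?_ 2
      rcases le_total u 0 with hu | hu
      · rw [min_eq_left hu]
      · rw [min_eq_right hu]; simp
    have := (hO.hasFDerivAt (𝕜 := ℝ) one_lt_two).hasDerivAt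
    simpa using this
  · rw [min_eq_right h.le, mul_zero]
    refine (hasDerivAt_const t (0 : ℝ)).congr_of_eventuallyEq ?_
    filter_upwards [Ioi_mem_nhds h] with u hu
    rw [min_eq_right (le_of_lt hu)]
    simp

/-- The sign of a component. -/
def componentSign {n : ℕ} (i : Fin n) : ℝ := if 2 * (i : ℕ) < n then 1 else -1

lemma componentSign_eq_or {n : ℕ} (i : Fin n) : componentSign i = 1 ∨ componentSign i = -1 := by
  unfold componentSign
  split_ifs <;> simp

lemma permSign_eq_componentSign {n : ℕ} (σ : Equiv.Perm (Fin n)) (i : Fin n) :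
    permSign σ i = componentSign (σ i) := by
  simp [permSign, componentSign]

/-- Isolating the squared negative part turns the case distinction into a sum of functions whose
derivatives and convexity are known. -/
lemma pieceComponent_eq (L G : ℝ) {n : ℕ} (i : Fin n) (t : ℝ) :
    pieceComponent L G i t
      = t ^ 2 / 2 + (L - 1) / 2 * min t 0 ^ 2 + G / 2 * componentSign i * t := by
  unfold pieceComponent componentSign
  have h1 : (if 0 ≤ t then t ^ 2 / 2 else L * t ^ 2 / 2)
      = t ^ 2 / 2 + (L - 1) / 2 * min t 0 ^ 2 := by
    split_ifs with h
    · rw [min_eq_right h]; ring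
    · rw [min_eq_left (not_le.1 h).le]; ring
  rw [h1]
  split_ifs <;> ring

lemma hasDerivAt_pieceComponent (L G : ℝ) {n : ℕ} (i : Fin n) (t : ℝ) :
    HasDerivAt (pieceComponent L G i) (hinge L t + G / 2 * componentSign i) t := by
  have h1 : HasDerivAt (fun u : ℝ => u ^ 2 / 2) t t := by
    simpa using (hasDerivAt_pow 2 t).div_const 2
  have h2 := (hasDerivAt_min_zero_sq t).const_mul ((L - 1) / 2)
  have h3 := (hasDerivAt_id t).const_mul (G / 2 * componentSign i)
  have h := (h1.add h2).add h3
  have e : pieceComponent L G i = fun u => u ^ 2 / 2 + (L - 1) / 2 * min u 0 ^ 2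
      + G / 2 * componentSign i * u := funext (pieceComponent_eq L G i)
  rw [e]
  refine HasDerivAt.congr_deriv (f' := _) h ?_
  rw [hinge_eq_sub_max, show max (-t) 0 = -min t 0 by rw [← neg_zero, max_neg_neg, neg_zero]]
  ring

lemma hinge_monotone {L : ℝ} (hL : 0 ≤ L) : Monotone (hinge L) := by
  intro x y hxy
  unfold hinge
  split_ifs with h1 h2 h2
  · exact hxy
  · linarith
  · nlinarith
  · exact mul_le_mul_of_nonneg_left hxy hL

lemma abs_hinge_sub_le {L : ℝ} (hL : 1 ≤ L) (x y : ℝ) :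
    |hinge L x - hinge L y| ≤ L * |x - y| := by
  wlog hxy : y ≤ x generalizing x y
  · rw [abs_sub_comm, abs_sub_comm x]
    exact this y x (le_of_not_ge hxy)
  rw [abs_of_nonneg (sub_nonneg.2 (hinge_monotone (by linarith) hxy)),
    abs_of_nonneg (sub_nonneg.2 hxy)]
  unfold hinge
  split_ifs with h1 h2 h2 <;> nlinarith

lemma convexOn_pieceComponent {L : ℝ} (hL : 0 ≤ L) (G : ℝ) {n : ℕ} (i : Fin n) :
    ConvexOn ℝ Set.univ (pieceComponent L G i) := by
  refine Monotone.convexOn_univ_of_deriv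
    (fun t => (hasDerivAt_pieceComponent L G i t).differentiableAt) ?_
  have : deriv (pieceComponent L G i) = fun t => hinge L t + G / 2 * componentSign i :=
    funext fun t => (hasDerivAt_pieceComponent L G i t).deriv
  rw [this]
  exact (hinge_monotone hL).add_const _

lemma convexOn_min_zero_sq : ConvexOn ℝ Set.univ fun t : ℝ => min t 0 ^ 2 := by
  refine Monotone.convexOn_univ_of_deriv
    (fun t => (hasDerivAt_min_zero_sq t).differentiableAt) ?_
  have : deriv (fun t : ℝ => min t 0 ^ 2) = fun t => 2 * min t 0 :=
    funext fun t => (hasDerivAt_min_zero_sq t).deriv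
  rw [this]
  intro x y hxy
  exact mul_le_mul_of_nonneg_left (min_le_min_right 0 hxy) (by norm_num)

/-- The sum of one-dimensional components in the two coordinates of the plane. -/
def planeComponent (L G : ℝ) {n : ℕ} (i : Fin n) (x : EuclideanSpace ℝ (Fin 2)) : ℝ :=
  pieceComponent L G i (x 0) + pieceComponent 1 G i (x 1)

variable {n : ℕ}

lemma hasGradientAt_planeComponent (L G : ℝ) (i : Fin n) (x : EuclideanSpace ℝ (Fin 2)) :
    HasGradientAt (planeComponent L G i)
      !₂[hinge L (x 0) + G / 2 * componentSign i, x 1 + G / 2 * componentSign i] x := by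
  rw [hasGradientAt_iff_hasFDerivAt]
  have h0 := (hasDerivAt_pieceComponent L G i (x 0)).comp_hasFDerivAt x
    (EuclideanSpace.proj (𝕜 := ℝ) (0 : Fin 2)).hasFDerivAt
  have h1 := (hasDerivAt_pieceComponent 1 G i (x 1)).comp_hasFDerivAt x
    (EuclideanSpace.proj (𝕜 := ℝ) (1 : Fin 2)).hasFDerivAt
  refine HasFDerivAt.congr_fderiv (h0.add h1) ?_
  ext v
  simp [PiLp.inner_apply, Fin.sum_univ_two, hinge_one]
  ring

lemma gradient_planeComponent (L G : ℝ) (i : Fin n) (x : EuclideanSpace ℝ (Fin 2)) :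
    gradient (planeComponent L G i) x
      = !₂[hinge L (x 0) + G / 2 * componentSign i, x 1 + G / 2 * componentSign i] :=
  (hasGradientAt_planeComponent L G i x).gradient

lemma convexOn_comp_coord {φ : ℝ → ℝ} (hφ : ConvexOn ℝ Set.univ φ) (k : Fin 2) :
    ConvexOn ℝ Set.univ fun x : EuclideanSpace ℝ (Fin 2) => φ (x k) :=
  hφ.comp_linearMap (EuclideanSpace.proj (𝕜 := ℝ) k).toLinearMap

lemma convexOn_planeComponent {L : ℝ} (hL : 0 ≤ L) (G : ℝ) (i : Fin n) :
    ConvexOn ℝ Set.univ (planeComponent L G i) :=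
  (convexOn_comp_coord (convexOn_pieceComponent hL G i) 0).add
    (convexOn_comp_coord (convexOn_pieceComponent zero_le_one G i) 1)

lemma norm_sq_plane (x : EuclideanSpace ℝ (Fin 2)) : ‖x‖ ^ 2 = x 0 ^ 2 + x 1 ^ 2 := by
  rw [EuclideanSpace.real_norm_sq_eq, Fin.sum_univ_two]

lemma norm_le_sqrt_two_mul {x : EuclideanSpace ℝ (Fin 2)} {r : ℝ} (h0 : |x 0| ≤ r)
    (h1 : |x 1| ≤ r) : ‖x‖ ≤ √2 * r := by
  have hr : 0 ≤ r := (abs_nonneg _).trans h0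
  refine le_of_sq_le_sq ?_ (by positivity)
  rw [norm_sq_plane, mul_pow, Real.sq_sqrt (by norm_num)]
  have := sq_le_sq' (abs_le.1 h0).1 (abs_le.1 h0).2
  have := sq_le_sq' (abs_le.1 h1).1 (abs_le.1 h1).2
  linarith

lemma lipschitzWith_gradient_planeComponent {L : NNReal} (hL : 1 ≤ L) (G : ℝ) (i : Fin n) :
    LipschitzWith L (gradient (planeComponent (L : ℝ) G i)) := by
  refine LipschitzWith.of_dist_le_mul fun x y => ?_
  have hLR : (1 : ℝ) ≤ L := by exact_mod_cast hL
  rw [dist_eq_norm, dist_eq_norm]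
  refine le_of_sq_le_sq ?_ (by positivity)
  rw [mul_pow, norm_sq_plane, norm_sq_plane, gradient_planeComponent, gradient_planeComponent]
  have h := abs_hinge_sub_le hLR (x 0) (y 0)
  have h2 : (hinge L (x 0) - hinge L (y 0)) ^ 2 ≤ (L : ℝ) ^ 2 * (x 0 - y 0) ^ 2 := by
    rw [← sq_abs, ← sq_abs (x 0 - y 0), ← mul_pow]
    exact pow_le_pow_left₀ (abs_nonneg _) h 2
  have h3 : 1 * (x 1 - y 1) ^ 2 ≤ (L : ℝ) ^ 2 * (x 1 - y 1) ^ 2 := by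
    gcongr
    exact one_le_pow₀ hLR
  simp
  linarith

lemma sum_componentSign (hn : 2 ∣ n) : ∑ i : Fin n, componentSign i = 0 := by
  have h := permSum_self hn (1 : Equiv.Perm (Fin n))
  rw [permSum, Finset.sum_range] at h
  simpa only [permSign_eq_componentSign, Equiv.Perm.one_apply] using h

/-- The linear terms cancel because the signs sum to zero. What remains is `‖x‖² / 2` plus a convex
nonnegative term, which shows strong convexity and the minimizer `0`. -/
lemma averageFn_planeComponent (hn : 2 ∣ n) (hpos : 0 < n) (L G : ℝ)
    (x : EuclideanSpace ℝ (Fin 2)) :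
    averageFn (planeComponent (n := n) L G) x
      = 1 / 2 * ‖x‖ ^ 2 + (L - 1) / 2 * min (x 0) 0 ^ 2 := by
  have hne : (n : ℝ) ≠ 0 := by exact_mod_cast hpos.ne'
  have h : ∀ i : Fin n, planeComponent L G i x
      = (1 / 2 * ‖x‖ ^ 2 + (L - 1) / 2 * min (x 0) 0 ^ 2)
        + (G / 2 * (x 0 + x 1)) * componentSign i := by
    intro i
    rw [planeComponent, pieceComponent_eq, pieceComponent_eq, norm_sq_plane]
    ring
  rw [averageFn, Finset.sum_congr rfl fun i _ => h i, Finset.sum_add_distrib, ← Finset.mul_sum,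
    sum_componentSign hn]
  simp only [Finset.sum_const, Finset.card_univ, Fintype.card_fin, nsmul_eq_mul]
  field_simp
  ring

lemma strongConvexOn_averageFn_planeComponent (hn : 2 ∣ n) (hpos : 0 < n) {L : ℝ} (hL : 1 ≤ L)
    (G : ℝ) : StrongConvexOn Set.univ 1 (averageFn (planeComponent (n := n) L G)) := by
  rw [strongConvexOn_iff_convex]
  have e : (fun x => averageFn (planeComponent (n := n) L G) x - 1 / 2 * ‖x‖ ^ 2)
      = fun x => ((L - 1) / 2) • (min (x 0) 0 ^ 2) := by
    funext x
    rw [averageFn_planeComponent hn hpos, smul_eq_mul]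
    ring
  rw [e]
  exact (convexOn_comp_coord convexOn_min_zero_sq 0).smul (by linarith)

lemma isMinOn_averageFn_planeComponent (hn : 2 ∣ n) (hpos : 0 < n) {L : ℝ} (hL : 1 ≤ L) (G : ℝ) :
    IsMinOn (averageFn (planeComponent (n := n) L G)) Set.univ 0 := by
  rw [isMinOn_iff]
  intro x _
  rw [averageFn_planeComponent hn hpos, averageFn_planeComponent hn hpos]
  have : 0 ≤ (L - 1) / 2 * min (x 0) 0 ^ 2 := mul_nonneg (by linarith) (sq_nonneg _)
  simp
  positivity

/-- A rectangle left invariant by gradient steps of size at most `1 / L`. -/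
def invariantRectangle (L G : ℝ) : Set (EuclideanSpace ℝ (Fin 2)) :=
  {x | (-(G / (2 * L)) ≤ x 0 ∧ x 0 ≤ G / 2) ∧ -(G / 2) ≤ x 1 ∧ x 1 ≤ G / 2}

lemma convex_invariantRectangle (L G : ℝ) : Convex ℝ (invariantRectangle L G) := by
  intro x hx y hy a b ha hb hab
  obtain ⟨⟨hx1, hx2⟩, hx3, hx4⟩ := hx
  obtain ⟨⟨hy1, hy2⟩, hy3, hy4⟩ := hy
  have key1 : ∀ {l u v : ℝ}, l ≤ u → l ≤ v → l ≤ a * u + b * v := fun {l u v} h1 h2 => by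
    have : l = a * l + b * l := by rw [← add_mul, hab, one_mul]
    rw [this]; gcongr
  have key2 : ∀ {l u v : ℝ}, u ≤ l → v ≤ l → a * u + b * v ≤ l := fun {l u v} h1 h2 => by
    have : l = a * l + b * l := by rw [← add_mul, hab, one_mul]
    rw [this]; gcongr
  exact ⟨⟨key1 hx1 hy1, key2 hx2 hy2⟩, key1 hx3 hy3, key2 hx4 hy4⟩

lemma div_two_mul_le {L G : ℝ} (hL : 1 ≤ L) (hG : 0 ≤ G) : G / (2 * L) ≤ G / 2 := by
  gcongr
  linarith

lemma norm_le_of_mem_invariantRectangle {L G : ℝ} (hL : 1 ≤ L) (hG : 0 ≤ G)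
    {x : EuclideanSpace ℝ (Fin 2)} (hx : x ∈ invariantRectangle L G) : ‖x‖ ≤ √2 * (G / 2) := by
  have h := div_two_mul_le hL hG
  obtain ⟨⟨hx1, hx2⟩, hx3, hx4⟩ := hx
  exact norm_le_sqrt_two_mul (abs_le.2 ⟨by linarith, hx2⟩) (abs_le.2 ⟨hx3, hx4⟩)

lemma norm_gradient_le_of_mem_invariantRectangle {L G : ℝ} (hL : 1 ≤ L) (hG : 0 ≤ G) (i : Fin n)
    {x : EuclideanSpace ℝ (Fin 2)} (hx : x ∈ invariantRectangle L G) :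
    ‖gradient (planeComponent L G i) x‖ ≤ √2 * G := by
  obtain ⟨⟨hx1, hx2⟩, hx3, hx4⟩ := hx
  have hm := hinge_monotone (by linarith : 0 ≤ L)
  have e1 : hinge L (G / 2) = G / 2 := if_pos (by linarith)
  have e2 : -(G / 2) ≤ hinge L (x 0) := by
    unfold hinge
    split_ifs with h
    · linarith
    · have := mul_le_mul_of_nonneg_left hx1 (by linarith : 0 ≤ L)
      rwa [show L * -(G / (2 * L)) = -(G / 2) by field_simp] at this
  have e3 := e1 ▸ hm hx2
  rw [gradient_planeComponent]
  refine norm_le_sqrt_two_mul (abs_le.2 ?_) (abs_le.2 ?_)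
  all_goals
    rcases componentSign_eq_or i with h | h <;> rw [h] <;> constructor <;> simp <;> linarith

lemma sub_smul_gradient_planeComponent_zero (L G α : ℝ) (i : Fin n)
    (x : EuclideanSpace ℝ (Fin 2)) :
    (x - α • gradient (planeComponent L G i) x) 0
      = x 0 - α * hinge L (x 0) - α * G / 2 * componentSign i := by
  rw [gradient_planeComponent]
  simp
  ring

lemma sub_smul_gradient_planeComponent_one (L G α : ℝ) (i : Fin n)
    (x : EuclideanSpace ℝ (Fin 2)) :
    (x - α • gradient (planeComponent L G i) x) 1
      = x 1 - α * hinge 1 (x 1) - α * G / 2 * componentSign i := by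
  rw [gradient_planeComponent, hinge_one]
  simp
  ring

/-- For `α * L ≤ 1` the noiseless step is monotone, so only the edges matter; at each edge the
restoring gradient has size `G / 2`, exactly enough to absorb the noise. -/
lemma sub_smul_gradient_mem_invariantRectangle {L G α : ℝ} (hL : 1 ≤ L) (hG : 0 ≤ G) (i : Fin n)
    {x : EuclideanSpace ℝ (Fin 2)} (hx : x ∈ invariantRectangle L G) (hα : 0 < α)
    (hαL : α ≤ 1 / L) :
    x - α • gradient (planeComponent L G i) x ∈ invariantRectangle L G := by
  obtain ⟨⟨hx1, hx2⟩, hx3, hx4⟩ := hx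
  have hαL' : α * L ≤ 1 := by rwa [le_div_iff₀ (by linarith)] at hαL
  have hα1 : α ≤ 1 := by nlinarith
  have hαG : α * G / 2 ≤ G / (2 * L) := by
    calc α * G / 2 ≤ 1 / L * G / 2 := by gcongr
      _ = G / (2 * L) := by field_simp
  have hαG0 : 0 ≤ α * G := by positivity
  have hmono := sub_mul_hinge_monotone hL hα.le hαL'
  have u0 := hmono hx2
  have l0 := hmono hx1
  have eu : hinge L (G / 2) = G / 2 := if_pos (by linarith)
  have l0' : -(G / (2 * L)) + α * G / 2 ≤ x 0 - α * hinge L (x 0) := by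
    refine le_trans ?_ l0
    have : hinge L (-(G / (2 * L))) ≤ -(G / 2) := by
      have hp : 0 ≤ G / (2 * L) := by positivity
      have h := abs_hinge_le hL (-(G / (2 * L)))
      unfold hinge
      split_ifs with h
      · have h0 : G / (2 * L) = 0 := by linarith
        have : G / 2 = L * (G / (2 * L)) := by field_simp
        rw [this, h0]
        simp
      · rw [show L * -(G / (2 * L)) = -(G / 2) by field_simp]
    have := mul_le_mul_of_nonneg_left this hα.le
    simp only
    linarith
  simp only [eu] at u0
  have q1 : (1 - α) * x 1 ≤ (1 - α) * (G / 2) := by gcongr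
  have q2 : (1 - α) * -(G / 2) ≤ (1 - α) * x 1 := by gcongr
  have hGL : 0 ≤ G / (2 * L) := by positivity
  refine ⟨⟨?_, ?_⟩, ?_, ?_⟩
  · rw [sub_smul_gradient_planeComponent_zero]
    rcases componentSign_eq_or i with h | h <;> rw [h] <;> linarith
  · rw [sub_smul_gradient_planeComponent_zero]
    rcases componentSign_eq_or i with h | h <;> rw [h] <;> linarith
  · rw [sub_smul_gradient_planeComponent_one, hinge_one]
    rcases componentSign_eq_or i with h | h <;> rw [h] <;> linarith
  · rw [sub_smul_gradient_planeComponent_one, hinge_one]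
    rcases componentSign_eq_or i with h | h <;> rw [h] <;> linarith

lemma sgdEpoch_planeComponent_zero (L G α : ℝ) (σ : Equiv.Perm (Fin n))
    (x : EuclideanSpace ℝ (Fin 2)) :
    (sgdEpoch (planeComponent L G) α σ x) 0
      = scalarIter L α (α * G / 2) (permSign σ) (x 0) n := by
  rw [sgdEpoch, Fin.map_foldl (fun y : EuclideanSpace ℝ (Fin 2) => y 0) _
    (fun t i => t - α * hinge L t - α * G / 2 * componentSign (σ i))
    fun y i => sub_smul_gradient_planeComponent_zero L G α (σ i) y]
  refine Fin.foldl_eq_of_succ _ _ (scalarIter L α (α * G / 2) (permSign σ) (x 0)) rfl fun i => ?_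
  rw [scalarIter, permSign_eq_componentSign]

lemma sgdEpoch_planeComponent_one (L G α : ℝ) (σ : Equiv.Perm (Fin n))
    (x : EuclideanSpace ℝ (Fin 2)) :
    (sgdEpoch (planeComponent L G) α σ x) 1
      = scalarIter 1 α (α * G / 2) (permSign σ) (x 1) n := by
  rw [sgdEpoch, Fin.map_foldl (fun y : EuclideanSpace ℝ (Fin 2) => y 1) _
    (fun t i => t - α * hinge 1 t - α * G / 2 * componentSign (σ i))
    fun y i => sub_smul_gradient_planeComponent_one L G α (σ i) y]
  refine Fin.foldl_eq_of_succ _ _ (scalarIter 1 α (α * G / 2) (permSign σ) (x 1)) rfl fun i => ?_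
  rw [scalarIter, permSign_eq_componentSign]

lemma sgdExpectedSqError_planeComponent (L G α : ℝ) (x : EuclideanSpace ℝ (Fin 2)) (K : ℕ) :
    sgdExpectedSqError (planeComponent (n := n) L G) α x 0 K
      = 𝔼 τ : Fin K → Equiv.Perm (Fin n),
        (scalarLast L α (α * G / 2) (x 0) τ ^ 2 + scalarLast 1 α (α * G / 2) (x 1) τ ^ 2) := by
  refine Finset.expect_congr rfl fun τ _ => ?_
  rw [sub_zero, norm_sq_plane, sgdLast, scalarLast, scalarLast,
    Fin.map_foldl (fun y : EuclideanSpace ℝ (Fin 2) => y 0) _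
      (fun t j => scalarIter L α (α * G / 2) (permSign (τ j)) t n)
      fun y j => sgdEpoch_planeComponent_zero L G α (τ j) y,
    Fin.map_foldl (fun y : EuclideanSpace ℝ (Fin 2) => y 1) _
      (fun t j => scalarIter 1 α (α * G / 2) (permSign (τ j)) t n)
      fun y j => sgdEpoch_planeComponent_one L G α (τ j) y]

end PlaneComponents

end

theorem corollary1 :
    ∃ c : ℝ, 0 < c ∧ ∀ G : ℝ, 0 < G → ∀ n : ℕ, 256 ≤ n → 4 ∣ n →
      ∃ (f : Fin n → EuclideanSpace ℝ (Fin 2) → ℝ) (x₀ xstar : EuclideanSpace ℝ (Fin 2))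
        (W : Set (EuclideanSpace ℝ (Fin 2))),
        -- the components: piecewise quadratic in one coordinate, quadratic in the other
        (∀ i x, f i x = pieceComponent (2 ^ 17) G i (x 0) + pieceComponent 1 G i (x 1)) ∧
        -- they are convex and smooth
        (∀ i, ConvexOn ℝ Set.univ (f i)) ∧
        (∀ i, Differentiable ℝ (f i)) ∧
        (∀ i, LipschitzWith (2 ^ 17) (gradient (f i))) ∧
        -- their average is strongly convex, with minimizer `xstar`
        StrongConvexOn Set.univ 1 (averageFn f) ∧
        IsMinOn (averageFn f) Set.univ xstar ∧
        -- bounded domain with bounded gradients, which the iterates do not leave when `α ≤ 1 / L`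
        Convex ℝ W ∧ x₀ ∈ W ∧ xstar ∈ W ∧
        (∀ x ∈ W, ‖x - xstar‖ ≤ √2 * (G / 2)) ∧
        (∀ i, ∀ x ∈ W, ‖gradient (f i) x‖ ≤ √2 * G) ∧
        (∀ i, ∀ x ∈ W, ∀ α : ℝ, 0 < α → α ≤ 1 / 2 ^ 17 → x - α • gradient (f i) x ∈ W) ∧
        -- the lower bound, for every number of epochs and every step size
        ∀ K : ℕ, 1 ≤ K → ∀ α : ℝ, 0 < α →
          c * G ^ 2 * (n : ℝ) / ((n : ℝ) * (K : ℝ)) ^ 2 ≤ sgdExpectedSqError f α x₀ xstar K := by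
  -- The large-step regime dictates the size: it yields `(2⁻²⁸)⁴ / 2¹⁰ = 2⁻¹²²`, rounded down to
  -- `2⁻¹²⁸`.
  refine ⟨1 / 2 ^ 128, by positivity, fun G hG n hn h4 => ?_⟩
  have h2 : 2 ∣ n := dvd_trans (by norm_num) h4
  have hpos : 0 < n := by omega
  have hL : (1 : ℝ) ≤ 2 ^ 17 := by norm_num
  have hGL : 0 ≤ G / (2 * 2 ^ 17) := by positivity
  refine ⟨planeComponent (2 ^ 17) G, !₂[G / 2, G / 2], 0, invariantRectangle (2 ^ 17) G,
    fun _ _ => rfl, convexOn_planeComponent (by positivity) G,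
    fun i x => (hasGradientAt_planeComponent _ G i x).differentiableAt, fun i => ?_,
    strongConvexOn_averageFn_planeComponent h2 hpos hL G,
    isMinOn_averageFn_planeComponent h2 hpos hL G, convex_invariantRectangle _ G, ?_, ?_,
    fun x hx => ?_, fun i x hx => norm_gradient_le_of_mem_invariantRectangle hL hG.le i hx,
    fun i x hx α hα hαL => sub_smul_gradient_mem_invariantRectangle hL hG.le i hx hα hαL,
    fun K hK α hα => ?_⟩
  · have h := lipschitzWith_gradient_planeComponent (L := 2 ^ 17) (by norm_num) G i
    push_cast at h
    exact h
  · refine ⟨⟨?_, ?_⟩, ?_, ?_⟩ <;> simp <;> linarith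
  · refine ⟨⟨?_, ?_⟩, ?_, ?_⟩ <;> simp <;> linarith
  · rw [sub_zero]
    exact norm_le_of_mem_invariantRectangle hL hG.le hx
  · rw [sgdExpectedSqError_planeComponent]
    exact le_expect_scalarLast_sq_add_sq h4 (by omega) hG hα hK
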